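/- For positive integers $k_1,\dots,k_n$ with $k_n\ge 2$ let $$\zeta^{\star}(k_1,\dots,k_n)=\sum_{0<m_1\le\cdots\le m_n}\frac{1}{m_1^{k_1}\cdots m_n^{k_n}}$$ denote the multiple zeta-star value. For integers $m,n\ge 0$ let $$S_m(\underbrace{1,\dots,1}_{n})=\sum_{0\le m_1<\cdots<m_n<m}\frac{1}{(m_1+1)\cdots(m_n+1)},\qquad S^{\star}_m(\underbrace{1,\dots,1}_{n})=\sum_{0\le m_1\le\cdots\le m_n\le m}\frac{1}{(m_1+1)\cdots(m_n+1)},$$ where both sums are $1$ for $n=0$, and an empty sum is $0$. Then for all integers $r\ge 0$ and $s\ge 2$ $$\zeta^{\star}(\underbrace{1,\dots,1}_{r+1},\underbrace{2,\dots,2}_{s-1}) =2\sum_{m=0}^{\infty}\frac{1}{(m+1)^{2s-1}}\left(\sum_{i=0}^{r}S_m(\underbrace{1,\dots,1}_{r-i})\,S^{\star}_m(\underbrace{1,\dots,1}_{i})\right),$$ where the series defining the left-hand side and the series on the right-hand side converge. -/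

import Mathlib

noncomputable section

/-- The summation range `0 < m₁ ≤ ⋯ ≤ mₙ` of the multiple zeta-star series. -/
def starRange (n : ℕ) : Set (Fin n → ℕ) :=
  {m | (∀ i, 0 < m i) ∧ Monotone m}

/-- The summand `1 / (m₁ ^ k₁ ⋯ mₙ ^ kₙ)`. -/
def starTerm {n : ℕ} (k m : Fin n → ℕ) : ℝ :=
  1 / ∏ i, (m i : ℝ) ^ k i

/-- The multiple zeta-star value `ζ⋆(k₁, …, kₙ)`, the sum of `1 / (m₁ ^ k₁ ⋯ mₙ ^ kₙ)` over
`0 < m₁ ≤ ⋯ ≤ mₙ`. -/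
def zetaStar {n : ℕ} (k : Fin n → ℕ) : ℝ :=
  ∑' m : starRange n, starTerm k (m : Fin n → ℕ)

open Classical in
/-- The finite multiple harmonic sum `S_m(k₁, …, kₙ)`, over `0 ≤ m₁ < ⋯ < mₙ < m`.
For `n = 0` it is `1` (one empty tuple, empty product). -/
def harmS (m : ℕ) {n : ℕ} (k : Fin n → ℕ) : ℝ :=
  ∑ x : Fin n → Fin m with StrictMono x, 1 / ∏ i, (((x i : ℕ) : ℝ) + 1) ^ k i

open Classical in
/-- The finite multiple harmonic star sum `S⋆_m(k₁, …, kₙ)`, over `0 ≤ m₁ ≤ ⋯ ≤ mₙ ≤ m`.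
For `n = 0` it is `1` (one empty tuple, empty product). -/
def harmSStar (m : ℕ) {n : ℕ} (k : Fin n → ℕ) : ℝ :=
  ∑ x : Fin n → Fin (m + 1) with Monotone x, 1 / ∏ i, (((x i : ℕ) : ℝ) + 1) ^ k i

/-- The constant index `(1, …, 1)` of length `n`. -/
def ones (n : ℕ) : Fin n → ℕ := fun _ => 1

/-- The index `(1, …, 1, 2, …, 2)` with `p` ones followed by `q` twos. -/
def onesTwos (p q : ℕ) : Fin (p + q) → ℕ :=
  Fin.append (fun _ => 1) (fun _ => 2)

end

noncomputable section

open Finset Filter Topology PowerSeries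

/-! The equality already holds for truncated sums, with a weight. Let ρ(n,N) = N!²/((N-n)!(N+n)!)
(`centralRatio`). The star sum over entries below N equals ∑_{n<N} 2 (n+1)^{-(2q+1)} I_r(n)
ρ(n+1,N), where I_r is `innerSum` and q counts the twos (`starSum_onesTwos_eq`). Since ρ(n,N+1) -
ρ(n,N) = n²/(N+1)² · ρ(n,N+1), appending a 2 to the index amounts to dividing by (n+1)². The case q
= 0 (`starSum_ones_eq`) is an induction on the number of ones; its step is a telescoping sum fed by
the recurrence of I_r (`innerSum_succ_succ`). As N → ∞, ρ increases to 1 and dominated convergence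
gives the theorem. -/

/-! ### Truncated sums and their recursions in the upper bound. -/

/-- Monotone tuples of length `n` with entries below `N`. -/
def monoTuples (n N : ℕ) : Finset (Fin n → ℕ) := by
  classical exact (Fintype.piFinset fun _ => range N).filter Monotone

/-- Strictly monotone tuples of length `n` with entries below `N`. -/
def strictMonoTuples (n N : ℕ) : Finset (Fin n → ℕ) := by
  classical exact (Fintype.piFinset fun _ => range N).filter StrictMono

/-- The summand `1 / ∏ (xᵢ + 1) ^ kᵢ` of the finite harmonic sums. -/
def harmTerm {n : ℕ} (k x : Fin n → ℕ) : ℝ := 1 / ∏ i, ((x i : ℝ) + 1) ^ k i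

/-- The finite star sum over `0 ≤ x₁ ≤ ⋯ ≤ xₙ < N`. -/
def starSum {n : ℕ} (k : Fin n → ℕ) (N : ℕ) : ℝ := ∑ x ∈ monoTuples n N, harmTerm k x

theorem mem_monoTuples {n N : ℕ} {x : Fin n → ℕ} :
    x ∈ monoTuples n N ↔ (∀ i, x i < N) ∧ Monotone x := by
  simp [monoTuples]

theorem mem_strictMonoTuples {n N : ℕ} {x : Fin n → ℕ} :
    x ∈ strictMonoTuples n N ↔ (∀ i, x i < N) ∧ StrictMono x := by
  simp [strictMonoTuples]

theorem harmTerm_nonneg {n : ℕ} (k x : Fin n → ℕ) : 0 ≤ harmTerm k x := by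
  unfold harmTerm; positivity

theorem harmTerm_snoc {n : ℕ} (k : Fin (n + 1) → ℕ) (x : Fin n → ℕ) (a : ℕ) :
    harmTerm k (Fin.snoc x a : Fin (n + 1) → ℕ) =
      1 / ((a : ℝ) + 1) ^ k (Fin.last n) * harmTerm (fun i => k i.castSucc) x := by
  simp only [harmTerm, Fin.prod_univ_castSucc, Fin.snoc_castSucc, Fin.snoc_last]
  rw [one_div_mul_one_div, mul_comm]

theorem snoc_right_injective {n : ℕ} (a : ℕ) :
    Function.Injective (fun x : Fin n → ℕ => (Fin.snoc x a : Fin (n + 1) → ℕ)) := by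
  intro x y h
  exact (Fin.snoc_injective2 h).1

/-- Split by whether the last entry is N. Removing it leaves entries that may still equal N, unlike
in the strict case. -/
theorem monoTuples_succ_succ (n N : ℕ) :
    monoTuples (n + 1) (N + 1) = monoTuples (n + 1) N ∪
      (monoTuples n (N + 1)).map ⟨_, snoc_right_injective N⟩ := by
  ext x
  simp only [mem_union, Finset.mem_map, mem_monoTuples, Function.Embedding.coeFn_mk]
  constructor
  · rintro ⟨hx, hm⟩
    by_cases h : x (Fin.last n) < N
    · exact Or.inl ⟨fun i => (hm (Fin.le_last i)).trans_lt h, hm⟩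
    · refine Or.inr ⟨fun i => x i.castSucc,
        ⟨fun i => hx _, fun i j hij => hm (Fin.castSucc_le_castSucc_iff.2 hij)⟩, ?_⟩
      have hN : x (Fin.last n) = N := by have := hx (Fin.last n); omega
      rw [← hN]
      exact Fin.snoc_init_self x
  · rintro (⟨hx, hm⟩ | ⟨y, ⟨hy, hm⟩, rfl⟩)
    · exact ⟨fun i => (hx i).trans (Nat.lt_succ_self N), hm⟩
    · refine ⟨fun i => ?_, fun i j hij => ?_⟩
      · induction i using Fin.lastCases with
        | last => simp
        | cast i => simpa using hy i
      · induction j using Fin.lastCases with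
        | last =>
          induction i using Fin.lastCases with
          | last => simp
          | cast i => simpa using Nat.lt_succ_iff.1 (hy i)
        | cast j =>
          induction i using Fin.lastCases with
          | last => exact absurd hij (not_le.2 (Fin.castSucc_lt_last j))
          | cast i => simpa using hm (Fin.castSucc_le_castSucc_iff.1 hij)

theorem strictMonoTuples_succ_succ (n N : ℕ) :
    strictMonoTuples (n + 1) (N + 1) = strictMonoTuples (n + 1) N ∪
      (strictMonoTuples n N).map ⟨_, snoc_right_injective N⟩ := by
  ext x
  simp only [mem_union, Finset.mem_map, mem_strictMonoTuples, Function.Embedding.coeFn_mk]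
  constructor
  · rintro ⟨hx, hm⟩
    by_cases h : x (Fin.last n) < N
    · exact Or.inl ⟨fun i => (hm.monotone (Fin.le_last i)).trans_lt h, hm⟩
    · have hN : x (Fin.last n) = N := by have := hx (Fin.last n); omega
      refine Or.inr ⟨fun i => x i.castSucc,
        ⟨fun i => (hm (Fin.castSucc_lt_last i)).trans_eq hN,
          fun i j hij => hm (Fin.castSucc_lt_castSucc_iff.2 hij)⟩, ?_⟩
      rw [← hN]
      exact Fin.snoc_init_self x
  · rintro (⟨hx, hm⟩ | ⟨y, ⟨hy, hm⟩, rfl⟩)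
    · exact ⟨fun i => (hx i).trans (Nat.lt_succ_self N), hm⟩
    · refine ⟨fun i => ?_, fun i j hij => ?_⟩
      · induction i using Fin.lastCases with
        | last => simp
        | cast i => simpa using (hy i).trans (Nat.lt_succ_self N)
      · induction j using Fin.lastCases with
        | last =>
          induction i using Fin.lastCases with
          | last => exact absurd hij (lt_irrefl _)
          | cast i => simpa using hy i
        | cast j =>
          induction i using Fin.lastCases with
          | last => exact absurd hij (not_lt.2 (Fin.castSucc_lt_last j).le)
          | cast i => simpa using hm (Fin.castSucc_lt_castSucc_iff.1 hij)

theorem starSum_succ_succ {n : ℕ} (k : Fin (n + 1) → ℕ) (N : ℕ) :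
    starSum k (N + 1) = starSum k N +
      1 / ((N : ℝ) + 1) ^ k (Fin.last n) * starSum (fun i => k i.castSucc) (N + 1) := by
  rw [starSum, monoTuples_succ_succ, sum_union, sum_map, starSum, starSum, mul_sum]
  · simp only [Function.Embedding.coeFn_mk, harmTerm_snoc]
  · rw [disjoint_left]
    intro x hx hx'
    obtain ⟨y, -, rfl⟩ := Finset.mem_map.1 hx'
    simpa using (mem_monoTuples.1 hx).1 (Fin.last n)

theorem starSum_zero_right {n : ℕ} (k : Fin (n + 1) → ℕ) : starSum k 0 = 0 := by
  refine sum_eq_zero fun x hx => absurd ((mem_monoTuples.1 hx).1 0) (Nat.not_lt_zero _)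

theorem starSum_length_zero (k : Fin 0 → ℕ) (N : ℕ) : starSum k N = 1 := by
  have : monoTuples 0 N = univ := by
    ext x; simp [mem_monoTuples, Subsingleton.monotone x, -univ_unique]
  simp [starSum, this, harmTerm]

theorem harmS_eq_sum (m : ℕ) {n : ℕ} (k : Fin n → ℕ) :
    harmS m k = ∑ x ∈ strictMonoTuples n m, harmTerm k x := by
  classical
  refine sum_bij (fun x _ i => (x i : ℕ)) (fun x hx => ?_) (fun x _ y _ h => ?_)
    (fun x hx => ?_) (fun x _ => rfl)
  · exact mem_strictMonoTuples.2 ⟨fun i => (x i).2, fun i j hij => (mem_filter.1 hx).2 hij⟩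
  · funext i; exact Fin.ext (congrFun h i)
  · obtain ⟨h, hm⟩ := mem_strictMonoTuples.1 hx
    exact ⟨fun i => ⟨x i, h i⟩, mem_filter.2 ⟨mem_univ _, fun i j hij => hm hij⟩, rfl⟩

theorem harmSStar_eq_starSum (m : ℕ) {n : ℕ} (k : Fin n → ℕ) :
    harmSStar m k = starSum k (m + 1) := by
  classical
  refine sum_bij (fun x _ i => (x i : ℕ)) (fun x hx => ?_) (fun x _ y _ h => ?_)
    (fun x hx => ?_) (fun x _ => rfl)
  · exact mem_monoTuples.2 ⟨fun i => (x i).2, fun i j hij => (mem_filter.1 hx).2 hij⟩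
  · funext i; exact Fin.ext (congrFun h i)
  · obtain ⟨h, hm⟩ := mem_monoTuples.1 hx
    exact ⟨fun i => ⟨x i, h i⟩, mem_filter.2 ⟨mem_univ _, fun i j hij => hm hij⟩, rfl⟩

theorem harmS_succ_succ (m : ℕ) {n : ℕ} (k : Fin (n + 1) → ℕ) :
    harmS (m + 1) k = harmS m k +
      1 / ((m : ℝ) + 1) ^ k (Fin.last n) * harmS m (fun i => k i.castSucc) := by
  simp only [harmS_eq_sum]
  rw [strictMonoTuples_succ_succ, sum_union, sum_map, mul_sum]
  · simp only [Function.Embedding.coeFn_mk, harmTerm_snoc]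
  · rw [disjoint_left]
    intro x hx hx'
    obtain ⟨y, -, rfl⟩ := Finset.mem_map.1 hx'
    simpa using (mem_strictMonoTuples.1 hx).1 (Fin.last n)

theorem harmS_zero_left {n : ℕ} (k : Fin (n + 1) → ℕ) : harmS 0 k = 0 := by
  rw [harmS_eq_sum]
  refine sum_eq_zero fun x hx => absurd ((mem_strictMonoTuples.1 hx).1 0) (Nat.not_lt_zero _)

theorem harmS_length_zero (m : ℕ) (k : Fin 0 → ℕ) : harmS m k = 1 := by
  have : strictMonoTuples 0 m = univ := by
    ext x; simp [mem_strictMonoTuples, Subsingleton.strictMono x, -univ_unique]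
  simp [harmS_eq_sum, this, harmTerm]

theorem harmS_ones_succ (m n : ℕ) :
    harmS (m + 1) (ones (n + 1)) =
      harmS m (ones (n + 1)) + 1 / ((m : ℝ) + 1) * harmS m (ones n) := by
  have := harmS_succ_succ m (ones (n + 1))
  rwa [show ones (n + 1) (Fin.last n) = 1 from rfl, pow_one] at this

theorem starSum_ones_succ (n N : ℕ) :
    starSum (ones (n + 1)) (N + 1) =
      starSum (ones (n + 1)) N + 1 / ((N : ℝ) + 1) * starSum (ones n) (N + 1) := by
  have := starSum_succ_succ (ones (n + 1)) N
  rwa [show ones (n + 1) (Fin.last n) = 1 from rfl, pow_one] at this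

theorem onesTwos_zero (p : ℕ) : onesTwos p 0 = ones p := by
  funext i
  exact Fin.append_left (n := 0) _ _ i

theorem starSum_onesTwos_succ (p q N : ℕ) :
    starSum (onesTwos p (q + 1)) (N + 1) = starSum (onesTwos p (q + 1)) N +
      1 / ((N : ℝ) + 1) ^ 2 * starSum (onesTwos p q) (N + 1) := by
  have h := starSum_succ_succ (n := p + q) (onesTwos p (q + 1)) N
  have hlast : onesTwos p (q + 1) (Fin.last (p + q)) = 2 :=
    Fin.append_right (n := q + 1) _ _ (Fin.last q)
  have hcast : (fun i : Fin (p + q) => onesTwos p (q + 1) i.castSucc) = onesTwos p q := by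
    funext i
    induction i using Fin.addCases with
    | left i =>
      exact (Fin.append_left (n := q + 1) _ _ i).trans
        (Fin.append_left (fun _ => 1) (fun _ => 2) i).symm
    | right i =>
      exact (Fin.append_right (n := q + 1) _ _ i.castSucc).trans
        (Fin.append_right (fun _ => 1) (fun _ => 2) i).symm
  rwa [hlast, hcast] at h

/-! ### The inner sum through generating series. -/

/-- The inner sum `∑ S_m(1, …, 1) S⋆_m(1, …, 1)` of total length `r`. -/
def innerSum (r m : ℕ) : ℝ :=
  ∑ i ∈ range (r + 1), harmS m (ones (r - i)) * harmSStar m (ones i)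

/-- The generating series of `harmS m (ones k)`. -/
def harmSeries (m : ℕ) : PowerSeries ℝ := PowerSeries.mk fun k => harmS m (ones k)

/-- The generating series of `starSum (ones k) N`. -/
def starSeries (N : ℕ) : PowerSeries ℝ := PowerSeries.mk fun k => starSum (ones k) N

theorem coeff_harmSeries_mul_starSeries (r m : ℕ) :
    coeff r (harmSeries m * starSeries (m + 1)) = innerSum r m := by
  rw [mul_comm, coeff_mul, Nat.sum_antidiagonal_eq_sum_range_succ_mk, innerSum]
  refine sum_congr rfl fun i _ => ?_
  simp [harmSeries, starSeries, harmSStar_eq_starSum, mul_comm]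

theorem harmSeries_succ (m : ℕ) :
    harmSeries (m + 1) = harmSeries m * (1 + C (1 / ((m : ℝ) + 1)) * X) := by
  ext k
  rw [mul_add, mul_one, ← mul_assoc, map_add]
  cases k with
  | zero => simp [harmSeries, harmS_length_zero]
  | succ k =>
    rw [coeff_succ_mul_X, coeff_mul_C]
    simp only [harmSeries, coeff_mk, harmS_ones_succ]
    ring

theorem starSeries_succ (N : ℕ) :
    starSeries (N + 1) * (1 - C (1 / ((N : ℝ) + 1)) * X) = starSeries N := by
  ext k
  rw [mul_sub, mul_one, ← mul_assoc, map_sub]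
  cases k with
  | zero => simp [starSeries, starSum_length_zero]
  | succ k =>
    rw [coeff_succ_mul_X, coeff_mul_C]
    simp only [starSeries, coeff_mk, starSum_ones_succ]
    ring

theorem innerSum_zero_left (m : ℕ) : innerSum 0 m = 1 := by
  simp [innerSum, harmS_length_zero, harmSStar_eq_starSum, starSum_length_zero]

theorem innerSum_zero_right (r : ℕ) : innerSum r 0 = 1 := by
  have h1 : harmSeries 0 = 1 := by
    ext k
    cases k with
    | zero => simp [harmSeries, harmS_length_zero]
    | succ k => simp [harmSeries, harmS_zero_left, coeff_one]
  rw [← coeff_harmSeries_mul_starSeries, h1, one_mul]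
  induction r with
  | zero => simp [starSeries, starSum_length_zero]
  | succ r ih =>
    simp only [starSeries, coeff_mk] at ih ⊢
    rw [starSum_ones_succ, starSum_zero_right, ih]
    simp

/-- The generating series is ∏_{j≤m}(1 - X/j)⁻¹(1 + X/j), j ≥ 1, times (1 - X/(m+1))⁻¹. The star
factor runs one step ahead, hence m+2 on one side and m+1 on the other. -/
theorem innerSum_succ_succ (r m : ℕ) :
    innerSum (r + 1) (m + 1) - innerSum r (m + 1) / ((m : ℝ) + 2) =
      innerSum (r + 1) m + innerSum r m / ((m : ℝ) + 1) := by
  have h : (harmSeries (m + 1) * starSeries (m + 1 + 1)) *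
        (1 - C (1 / (((m + 1 : ℕ) : ℝ) + 1)) * X) =
      (harmSeries m * starSeries (m + 1)) * (1 + C (1 / ((m : ℝ) + 1)) * X) := by
    rw [mul_assoc, starSeries_succ, harmSeries_succ]
    ring
  have h2 := congrArg (coeff (r + 1)) h
  rw [mul_sub, mul_add, mul_one, mul_one, ← mul_assoc, ← mul_assoc, map_sub, map_add,
    coeff_succ_mul_X, coeff_succ_mul_X, coeff_mul_C, coeff_mul_C] at h2
  simp only [coeff_harmSeries_mul_starSeries] at h2
  push_cast at h2
  rw [show (m : ℝ) + 1 + 1 = m + 2 by ring] at h2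
  rw [div_eq_mul_one_div, h2, div_eq_mul_one_div (innerSum r m)]

/-! ### The weight ρ and its difference equation. -/

/-- The ratio `N! ^ 2 / ((N - n)! (N + n)!)`, which vanishes for `n > N`. -/
def centralRatio (n N : ℕ) : ℝ := ∏ i ∈ range n, ((N : ℝ) - i) / ((N : ℝ) + 1 + i)

theorem centralRatio_succ (n N : ℕ) :
    centralRatio (n + 1) N = centralRatio n N * (((N : ℝ) - n) / ((N : ℝ) + 1 + n)) :=
  prod_range_succ _ _

theorem centralRatio_eq_zero {n N : ℕ} (h : N < n) : centralRatio n N = 0 :=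
  prod_eq_zero (mem_range.2 h) (by simp)

theorem centralRatio_nonneg (n N : ℕ) : 0 ≤ centralRatio n N := by
  rcases lt_or_ge N n with h | h
  · exact (centralRatio_eq_zero h).ge
  · refine prod_nonneg fun i hi => div_nonneg ?_ (by positivity)
    have : (i : ℝ) ≤ N := by exact_mod_cast (mem_range.1 hi).le.trans h
    linarith

theorem centralRatio_le_one (n N : ℕ) : centralRatio n N ≤ 1 := by
  rcases lt_or_ge N n with h | h
  · exact (centralRatio_eq_zero h).trans_le zero_le_one
  · have hi' : ∀ i ∈ range n, (i : ℝ) ≤ N := fun i hi => by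
      exact_mod_cast (mem_range.1 hi).le.trans h
    refine prod_le_one (fun i hi => div_nonneg (by linarith [hi' i hi]) (by positivity))
      fun i hi => ?_
    rw [div_le_one (by positivity)]
    have : (0 : ℝ) ≤ i := by positivity
    linarith

theorem tendsto_centralRatio (n : ℕ) : Tendsto (centralRatio n) atTop (𝓝 1) := by
  have h : ∀ i ∈ range n,
      Tendsto (fun N : ℕ => ((N : ℝ) - i) / ((N : ℝ) + 1 + i)) atTop (𝓝 1) := by
    intro i _
    have h0 : Tendsto (fun N : ℕ => 1 - (1 + 2 * (i : ℝ)) / ((N : ℝ) + (1 + i))) atTop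
        (𝓝 (1 - 0)) :=
      tendsto_const_nhds.sub (tendsto_const_nhds.div_atTop
        (tendsto_atTop_add_const_right _ _ tendsto_natCast_atTop_atTop))
    rw [sub_zero] at h0
    refine h0.congr fun N => ?_
    have : (N : ℝ) + 1 + i ≠ 0 := by positivity
    rw [← add_assoc]
    field_simp
    ring
  have hprod := tendsto_finsetProd (range n) h
  rwa [prod_const_one] at hprod

theorem centralRatio_mul_sq (n N : ℕ) :
    centralRatio n N * ((N : ℝ) + 1) ^ 2 =
      centralRatio n (N + 1) * (((N : ℝ) + 1) ^ 2 - (n : ℝ) ^ 2) := by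
  induction n with
  | zero => simp [centralRatio]
  | succ n ih =>
    have h1 : (N : ℝ) + 1 + n ≠ 0 := by positivity
    have h2 : (N : ℝ) + 1 + 1 + n ≠ 0 := by positivity
    rw [centralRatio_succ, centralRatio_succ, mul_right_comm, ih]
    push_cast
    field_simp
    ring

theorem centralRatio_sub (n N : ℕ) :
    centralRatio n (N + 1) - centralRatio n N =
      (n : ℝ) ^ 2 / ((N : ℝ) + 1) ^ 2 * centralRatio n (N + 1) := by
  have h : (N : ℝ) + 1 ≠ 0 := by positivity
  have := centralRatio_mul_sq n N
  field_simp
  linarith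

/-! ### The weighted finite identity. -/

theorem sum_centralRatio_mul_sub (a : ℕ → ℝ) (N : ℕ) :
    ∑ n ∈ range (N + 1), a n * centralRatio (n + 1) (N + 1) -
        ∑ n ∈ range N, a n * centralRatio (n + 1) N =
      1 / ((N : ℝ) + 1) ^ 2 *
        ∑ n ∈ range (N + 1), ((n : ℝ) + 1) ^ 2 * a n * centralRatio (n + 1) (N + 1) := by
  -- The added term n = N carries ρ(N+1,N) = 0, so both sums share one range.
  have h : ∑ n ∈ range N, a n * centralRatio (n + 1) N =
      ∑ n ∈ range (N + 1), a n * centralRatio (n + 1) N := by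
    rw [sum_range_succ, centralRatio_eq_zero (Nat.lt_succ_self N), mul_zero, add_zero]
  rw [h, ← sum_sub_distrib, mul_sum]
  refine sum_congr rfl fun n _ => ?_
  rw [← mul_sub, centralRatio_sub]
  push_cast
  ring

theorem sum_range_telescope_zero (N M : ℕ) :
    ∑ n ∈ range M, ((n : ℝ) + 1) * centralRatio (n + 1) N * 2 =
      N - (N + M + 1) * centralRatio (M + 1) N := by
  induction M with
  | zero =>
    have : (N : ℝ) + 1 ≠ 0 := by positivity
    simp [centralRatio]
    field_simp
    ring
  | succ M ih =>
    have : (N : ℝ) + 1 + ((M + 1 : ℕ) : ℝ) ≠ 0 := by positivity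
    rw [sum_range_succ, ih, centralRatio_succ (M + 1)]
    field_simp
    push_cast
    ring

/-- There is no constant term because I_{r+1}(0) = I_r(0) = 1. At M = N the right side vanishes,
which trades (n+1) I_{r+1}(n) for N I_r(n)/(n+1) under the weighted sum. -/
theorem sum_range_telescope_succ (r N M : ℕ) :
    ∑ n ∈ range M, (((n : ℝ) + 1) * innerSum (r + 1) n - N / ((n : ℝ) + 1) * innerSum r n) *
        centralRatio (n + 1) N * 2 =
      - ((N + M + 1) * centralRatio (M + 1) N *
          (innerSum (r + 1) M - innerSum r M / ((M : ℝ) + 1))) := by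
  induction M with
  | zero => simp [innerSum_zero_right]
  | succ M ih =>
    have h1 : (N : ℝ) + 1 + ((M + 1 : ℕ) : ℝ) ≠ 0 := by positivity
    have h2 : (M : ℝ) + 1 ≠ 0 := by positivity
    have h3 := innerSum_succ_succ r M
    rw [sum_range_succ, ih, centralRatio_succ (M + 1),
      show ((M + 1 : ℕ) : ℝ) + 1 = M + 2 by push_cast; ring, h3]
    field_simp
    push_cast
    ring

theorem starSum_ones_eq (r N : ℕ) :
    starSum (ones (r + 1)) N =
      ∑ n ∈ range N, 2 / ((n : ℝ) + 1) * innerSum r n * centralRatio (n + 1) N := by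
  induction r generalizing N with
  | zero =>
    induction N with
    | zero => simp [starSum_zero_right]
    | succ N ih =>
      have h := sum_centralRatio_mul_sub (fun n => 2 / ((n : ℝ) + 1) * innerSum 0 n) N
      have h2 := sum_range_telescope_zero (N + 1) (N + 1)
      rw [centralRatio_eq_zero (Nat.lt_succ_self _), mul_zero, sub_zero] at h2
      have h3 : ∑ n ∈ range (N + 1), ((n : ℝ) + 1) ^ 2 * (2 / ((n : ℝ) + 1) * innerSum 0 n) *
          centralRatio (n + 1) (N + 1) = ((N + 1 : ℕ) : ℝ) := by
        rw [← h2]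
        refine sum_congr rfl fun n _ => ?_
        have : (n : ℝ) + 1 ≠ 0 := by positivity
        rw [innerSum_zero_left]
        field_simp
      rw [h3, ← ih] at h
      rw [starSum_ones_succ, starSum_length_zero, sub_eq_iff_eq_add'.1 h]
      have : (N : ℝ) + 1 ≠ 0 := by positivity
      push_cast
      field_simp
  | succ r ihr =>
    induction N with
    | zero => simp [starSum_zero_right]
    | succ N ih =>
      have h := sum_centralRatio_mul_sub (fun n => 2 / ((n : ℝ) + 1) * innerSum (r + 1) n) N
      have h2 := sum_range_telescope_succ r (N + 1) (N + 1)
      rw [centralRatio_eq_zero (Nat.lt_succ_self _), mul_zero, zero_mul, neg_zero] at h2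
      -- The vanishing telescoped sum turns this into N+1 times the weighted sum for r, so the
      -- increment in N is the one from appending a 1.
      have h3 : ∑ n ∈ range (N + 1), ((n : ℝ) + 1) ^ 2 *
          (2 / ((n : ℝ) + 1) * innerSum (r + 1) n) * centralRatio (n + 1) (N + 1) =
          ((N : ℝ) + 1) * starSum (ones (r + 1)) (N + 1) := by
        rw [ihr, mul_sum, ← sub_eq_zero, ← sum_sub_distrib, ← h2]
        refine sum_congr rfl fun n _ => ?_
        have : (n : ℝ) + 1 ≠ 0 := by positivity
        push_cast
        field_simp
      rw [h3, ← ih] at h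
      rw [starSum_ones_succ, sub_eq_iff_eq_add'.1 h]
      have : (N : ℝ) + 1 ≠ 0 := by positivity
      field_simp

theorem starSum_onesTwos_eq (r q N : ℕ) :
    starSum (onesTwos (r + 1) q) N =
      ∑ n ∈ range N, 2 / ((n : ℝ) + 1) ^ (2 * q + 1) * innerSum r n * centralRatio (n + 1) N := by
  induction q generalizing N with
  | zero => simpa [onesTwos_zero] using starSum_ones_eq r N
  | succ q ihq =>
    induction N with
    | zero => exact starSum_zero_right (n := r + 1 + q) _
    | succ N ih =>
      have h := sum_centralRatio_mul_sub
        (fun n => 2 / ((n : ℝ) + 1) ^ (2 * (q + 1) + 1) * innerSum r n) N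
      rw [starSum_onesTwos_succ, ihq, ih, ← eq_sub_iff_add_eq', h]
      congr 1
      refine sum_congr rfl fun n _ => ?_
      have : (n : ℝ) + 1 ≠ 0 := by positivity
      field_simp
      ring

/-! ### Logarithmic growth of the inner sum and summability. -/

theorem starSum_ones_le (k N : ℕ) : starSum (ones k) N ≤ (harmonic N : ℝ) ^ k := by
  induction k generalizing N with
  | zero => simp [starSum_length_zero]
  | succ k ihk =>
    have hpos : ∀ N, (0 : ℝ) ≤ harmonic N := fun N => by
      exact_mod_cast sum_nonneg fun _ _ => by positivity
    induction N with
    | zero => rw [starSum_zero_right]; exact pow_nonneg (hpos 0) _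
    | succ N ih =>
      have hs : (harmonic (N + 1) : ℝ) = harmonic N + 1 / ((N : ℝ) + 1) := by
        rw [harmonic_succ]; push_cast; rw [one_div]
      have hle : (harmonic N : ℝ) ≤ harmonic (N + 1) := by
        rw [hs]; exact le_add_of_nonneg_right (by positivity)
      calc starSum (ones (k + 1)) (N + 1)
          = starSum (ones (k + 1)) N + 1 / ((N : ℝ) + 1) * starSum (ones k) (N + 1) :=
            starSum_ones_succ k N
        _ ≤ (harmonic N : ℝ) ^ (k + 1) +
              1 / ((N : ℝ) + 1) * (harmonic (N + 1) : ℝ) ^ k := by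
            gcongr
            exact ihk _
        _ ≤ (harmonic N : ℝ) * (harmonic (N + 1) : ℝ) ^ k +
              1 / ((N : ℝ) + 1) * (harmonic (N + 1) : ℝ) ^ k := by
            rw [pow_succ']
            gcongr
            · exact hpos N
            · exact hpos N
        _ = (harmonic (N + 1) : ℝ) ^ (k + 1) := by
            rw [← add_mul, ← hs, pow_succ']

theorem harmS_nonneg (m : ℕ) {n : ℕ} (k : Fin n → ℕ) : 0 ≤ harmS m k := by
  rw [harmS_eq_sum]
  exact sum_nonneg fun x _ => harmTerm_nonneg k x

theorem starSum_nonneg {n : ℕ} (k : Fin n → ℕ) (N : ℕ) : 0 ≤ starSum k N :=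
  sum_nonneg fun x _ => harmTerm_nonneg k x

theorem harmS_le_starSum (m : ℕ) {n : ℕ} (k : Fin n → ℕ) : harmS m k ≤ starSum k (m + 1) := by
  rw [harmS_eq_sum]
  refine sum_le_sum_of_subset_of_nonneg (fun x hx => ?_) fun x _ _ => harmTerm_nonneg k x
  obtain ⟨h, hm⟩ := mem_strictMonoTuples.1 hx
  exact mem_monoTuples.2 ⟨fun i => (h i).trans (Nat.lt_succ_self m), hm.monotone⟩

theorem innerSum_nonneg (r m : ℕ) : 0 ≤ innerSum r m :=
  sum_nonneg fun _ _ => mul_nonneg (harmS_nonneg m _)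
    (harmSStar_eq_starSum m (ones _) ▸ starSum_nonneg _ _)

theorem innerSum_le (r m : ℕ) :
    innerSum r m ≤ (r + 1) * (1 + Real.log ((m : ℝ) + 1)) ^ r := by
  have hb : ∀ k, starSum (ones k) (m + 1) ≤ (1 + Real.log ((m : ℝ) + 1)) ^ k := fun k => by
    refine (starSum_ones_le k _).trans ?_
    have h := harmonic_le_one_add_log (m + 1)
    push_cast at h
    have hpos : (0 : ℝ) ≤ harmonic (m + 1) := by
      exact_mod_cast sum_nonneg fun _ _ => by positivity
    gcongr
  have hL : 0 ≤ 1 + Real.log ((m : ℝ) + 1) := by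
    have := Real.log_nonneg (show (1 : ℝ) ≤ (m : ℝ) + 1 by simp)
    linarith
  calc innerSum r m ≤ ∑ _i ∈ range (r + 1), (1 + Real.log ((m : ℝ) + 1)) ^ r := by
        refine sum_le_sum fun i hi => ?_
        rw [harmSStar_eq_starSum]
        calc _ ≤ (1 + Real.log ((m : ℝ) + 1)) ^ (r - i) * (1 + Real.log ((m : ℝ) + 1)) ^ i :=
              mul_le_mul ((harmS_le_starSum m _).trans (hb _)) (hb _) (starSum_nonneg _ _)
                (pow_nonneg hL _)
          _ = _ := by rw [← pow_add, Nat.sub_add_cancel (Nat.lt_succ_iff.1 (mem_range.1 hi))]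
    _ = _ := by simp

theorem summable_innerSum (r : ℕ) {k : ℕ} (hk : 3 ≤ k) :
    Summable fun m : ℕ => 1 / ((m : ℝ) + 1) ^ k * innerSum r m := by
  have hsq : Summable fun m : ℕ => 1 / ((m : ℝ) + 1) ^ 2 := by
    have := (summable_nat_add_iff 1).2 (Real.summable_one_div_nat_pow.2 one_lt_two)
    simpa using this
  -- The factor e absorbs the constant: 1 + log(m+1) = log(e(m+1)), whose r-th power is o(m).
  have hlin : Tendsto (fun m : ℕ => Real.exp 1 * ((m : ℝ) + 1)) atTop atTop :=
    (tendsto_atTop_add_const_right _ _ tendsto_natCast_atTop_atTop).const_mul_atTop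
      (Real.exp_pos 1)
  have hlog := (Real.isLittleO_pow_log_id_atTop (n := r)).comp_tendsto hlin
  have hev := hlog.def one_pos
  refine Summable.of_norm_bounded_eventually_nat (hsq.mul_left ((r + 1) * Real.exp 1)) ?_
  filter_upwards [hev] with m hm
  have hm1 : (0 : ℝ) < (m : ℝ) + 1 := by positivity
  simp only [Function.comp_apply, id, one_mul] at hm
  rw [Real.log_mul (Real.exp_pos 1).ne' hm1.ne', Real.log_exp,
    Real.norm_of_nonneg (mul_pos (Real.exp_pos 1) hm1).le] at hm
  have hle : innerSum r m ≤ (r + 1) * (Real.exp 1 * ((m : ℝ) + 1)) :=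
    (innerSum_le r m).trans (by gcongr; exact (Real.le_norm_self _).trans hm)
  rw [Real.norm_of_nonneg (mul_nonneg (by positivity) (innerSum_nonneg r m))]
  calc 1 / ((m : ℝ) + 1) ^ k * innerSum r m
      ≤ 1 / ((m : ℝ) + 1) ^ 3 * ((r + 1) * (Real.exp 1 * ((m : ℝ) + 1))) := by
        refine mul_le_mul ?_ hle (innerSum_nonneg r m) (by positivity)
        gcongr
        linarith
    _ = _ := by field_simp

/-! ### Passage to the limit. -/

theorem tendsto_starSum_onesTwos (r q : ℕ) :
    Tendsto (starSum (onesTwos (r + 1) (q + 1))) atTop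
      (𝓝 (2 * ∑' m : ℕ, 1 / ((m : ℝ) + 1) ^ (2 * (q + 1) + 1) * innerSum r m)) := by
  have hsum := (summable_innerSum r (k := 2 * (q + 1) + 1) (by omega)).mul_left 2
  have hnn : ∀ n : ℕ, 0 ≤ 2 * (1 / ((n : ℝ) + 1) ^ (2 * (q + 1) + 1) * innerSum r n) :=
    fun n => mul_nonneg zero_le_two (mul_nonneg (by positivity) (innerSum_nonneg r n))
  -- Since 0 ≤ ρ ≤ 1, the unweighted series dominates; terms with n ≥ N vanish, so the full series
  -- is the finite sum.
  have h := tendsto_tsum_of_dominated_convergence (𝓕 := atTop)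
    (f := fun N n : ℕ => 2 * (1 / ((n : ℝ) + 1) ^ (2 * (q + 1) + 1) * innerSum r n) *
      centralRatio (n + 1) N)
    (g := fun n : ℕ => 2 * (1 / ((n : ℝ) + 1) ^ (2 * (q + 1) + 1) * innerSum r n))
    hsum (fun n => by simpa using (tendsto_centralRatio (n + 1)).const_mul _)
    (Eventually.of_forall fun N n => by
      rw [Real.norm_of_nonneg (mul_nonneg (hnn n) (centralRatio_nonneg _ _))]
      exact mul_le_of_le_one_right (hnn n) (centralRatio_le_one _ _))
  rw [tsum_mul_left] at h
  refine h.congr fun N => ?_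
  rw [starSum_onesTwos_eq, tsum_eq_sum (s := range N)]
  · exact sum_congr rfl fun n _ => by ring
  · intro n hn
    rw [centralRatio_eq_zero (Nat.lt_succ_iff.2 (not_lt.1 fun h => hn (mem_range.2 h))), mul_zero]

/-- Shifting a monotone tuple by one lands in the range of the multiple zeta-star series. -/
def starRangeEquiv (n : ℕ) : {x : Fin n → ℕ // Monotone x} ≃ starRange n where
  toFun x := ⟨fun i => x.1 i + 1, fun i => Nat.succ_pos _, fun _ _ h => Nat.succ_le_succ (x.2 h)⟩
  invFun m := ⟨fun i => m.1 i - 1, fun _ _ h => Nat.sub_le_sub_right (m.2.2 h) 1⟩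
  left_inv x := by ext i; simp
  right_inv m := by ext i; exact Nat.sub_add_cancel (m.2.1 i)

theorem starTerm_starRangeEquiv {n : ℕ} (k : Fin n → ℕ) (x : {x : Fin n → ℕ // Monotone x}) :
    starTerm k (starRangeEquiv n x : Fin n → ℕ) = harmTerm k x := by
  simp [starTerm, harmTerm, starRangeEquiv]

/-- A multiple zeta-star series converges to the limit of its truncations. -/
theorem hasSum_starTerm_of_tendsto {n : ℕ} (k : Fin n → ℕ) {a : ℝ}
    (h : Tendsto (starSum k) atTop (𝓝 a)) :
    HasSum (fun m : starRange n => starTerm k (m : Fin n → ℕ)) a := by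
  classical
  rw [← (starRangeEquiv n).hasSum_iff]
  simp only [Function.comp_def, starTerm_starRangeEquiv]
  let F : ℕ → Finset {x : Fin n → ℕ // Monotone x} :=
    fun N => (monoTuples n N).subtype Monotone
  have hF : ∀ N, ∑ x ∈ F N, harmTerm k x = starSum k N := fun N =>
    sum_subtype_of_mem (harmTerm k) fun x hx => (mem_monoTuples.1 hx).2
  have hmono : Monotone F := fun N M hNM x hx => by
    simp only [F, mem_subtype, mem_monoTuples] at hx ⊢
    exact ⟨fun i => (hx.1 i).trans_le hNM, hx.2⟩
  have hexh : ∀ x, ∃ N, x ∈ F N := fun x => by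
    refine ⟨(univ.sup x.1) + 1, ?_⟩
    simp only [F, mem_subtype, mem_monoTuples]
    exact ⟨fun i => Nat.lt_succ_of_le (le_sup (f := x.1) (mem_univ i)), x.2⟩
  have htend := tendsto_atTop_finset_of_monotone hmono hexh
  have hs : Monotone (starSum k) := fun N M hNM => by
    rw [← hF, ← hF]
    exact sum_le_sum_of_subset_of_nonneg (hmono hNM) fun x _ _ => harmTerm_nonneg k x
  -- Terms are nonnegative and every finite set lies in some truncation, so `a` bounds all finite
  -- sums.
  have hsummable : Summable fun x : {x : Fin n → ℕ // Monotone x} => harmTerm k x := by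
    refine summable_of_sum_le (c := a) (fun x => harmTerm_nonneg k x) fun u => ?_
    obtain ⟨N, hN⟩ := (htend.eventually_ge_atTop u).exists
    exact (sum_le_sum_of_subset_of_nonneg hN fun x _ _ => harmTerm_nonneg k x).trans
      ((hF N).trans_le (hs.ge_of_tendsto h N))
  have hlim := hsummable.hasSum.comp htend
  have : a = ∑' x : {x : Fin n → ℕ // Monotone x}, harmTerm k x :=
    tendsto_nhds_unique h (hlim.congr fun N => hF N)
  rw [this]
  exact hsummable.hasSum

end

theorem mainTheorem3 (r s : ℕ) (hs : 2 ≤ s) :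
    Summable (fun m : starRange (r + 1 + (s - 1)) =>
        starTerm (onesTwos (r + 1) (s - 1)) (m : Fin (r + 1 + (s - 1)) → ℕ)) ∧
      Summable (fun m : ℕ => 1 / ((m : ℝ) + 1) ^ (2 * s - 1) *
        ∑ i ∈ Finset.range (r + 1), harmS m (ones (r - i)) * harmSStar m (ones i)) ∧
      zetaStar (onesTwos (r + 1) (s - 1)) =
        2 * ∑' m : ℕ, 1 / ((m : ℝ) + 1) ^ (2 * s - 1) *
          ∑ i ∈ Finset.range (r + 1), harmS m (ones (r - i)) * harmSStar m (ones i) := by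
  -- At least one 2 is present, so the exponent 2(q+1)+1 is at least 3, as `summable_innerSum`
  -- needs.
  obtain ⟨q, hq⟩ : ∃ q, s - 1 = q + 1 := ⟨s - 2, by omega⟩
  have he : 2 * s - 1 = 2 * (q + 1) + 1 := by omega
  rw [hq, he]
  have h := hasSum_starTerm_of_tendsto _ (tendsto_starSum_onesTwos r q)
  exact ⟨h.summable, summable_innerSum r (by omega), h.tsum_eq⟩
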